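/- Consider a human and an aerial robot connected by a cable. Their positions $p_H,p_R\in\mathbb R^3$ are expressed in an inertial frame with vertical unit axis $z_W=(0,0,1)^\top$ opposite to gravity, and the state is $x=(p_H,\dot p_H,p_R,\dot p_R)$. The dynamics are $$m_H\ddot p_H=-m_H g\,z_W-D_H\dot p_H+f_c+f_g,\qquad M_A\ddot p_R=-D_A\dot p_R-f_c+u_A,$$ where $m_H,g>0$, the matrices $D_H,M_A,D_A\in\mathbb R^{3\times3}$ are symmetric positive definite, and $f_c$ is the force of the cable, a unilateral spring with stiffness $k_c>0$ and nominal length $L>0$: with $l_c=p_R-p_H$, $f_c=k_c(\|l_c\|-L)\,l_c/\|l_c\|$ if $\|l_c\|>L$ and $f_c=0$ otherwise. The human is constrained to the ground: the state space is $\mathcal X=\{x: z_W^\top p_H=z_W^\top\dot p_H=0\}$, and the ground reaction $f_g$ is the vertical force (parallel to $z_W$) for which $z_W^\top\ddot p_H=0$. Let $p_H^r\in\mathbb R^3$ with $z_W^\top p_H^r=0$, $k_p>0$, $K_p=\mathrm{diag}(k_p,k_p,0)$, $f_{ref}=f_z z_W$ with $f_z\in\mathbb R$, $f_z\neq0$,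 and $$p_R^r=p_H^r+f_{ref}\Big(\frac1{k_c}+\frac{L}{\|f_{ref}\|}\Big),\qquad e_R=p_R^r-p_R .$$ Apply the control law $u_A=\Gamma_H(x)=K_p e_R+f_{ref}+D_A\dot p_H$. If $D_H-\tfrac14D_A\succ0$ (positive definite), then the zero-velocity state $x_{eq}=(p_H^r,0,p_R^r,0)$ is an asymptotically stable equilibrium of the closed-loop system on $\mathcal X$. That is, $x_{eq}\in\mathcal X$ is an equilibrium; it is Lyapunov stable; and every initial state in $\mathcal X$ sufficiently close to $x_{eq}$ is the start of a solution on $[0,\infty)$, and every such solution converges to $x_{eq}$ as $t\to\infty$. -/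

import Mathlib

noncomputable section

namespace TetheredGuide

open Matrix

/-- Physical space, with the Euclidean norm; coordinates are those of the inertial world frame. -/
abbrev E3 : Type := EuclideanSpace ℝ (Fin 3)

/-- The action of a `3 × 3` real matrix on a vector of `E3`. -/
def act (A : Matrix (Fin 3) (Fin 3) ℝ) (v : E3) : E3 := WithLp.toLp 2 (A *ᵥ v.ofLp)

/-- The vertical unit axis of the world frame, pointing opposite to gravity. -/
def zW : E3 := !₂[0, 0, 1]

/-- The numerical data of the human-cable-robot system. -/
structure Params where
  /-- mass of the human -/
  mH : ℝ
  /-- apparent damping of the human -/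
  DH : Matrix (Fin 3) (Fin 3) ℝ
  /-- virtual (admittance) inertia of the robot -/
  MA : Matrix (Fin 3) (Fin 3) ℝ
  /-- virtual (admittance) damping of the robot -/
  DA : Matrix (Fin 3) (Fin 3) ℝ
  /-- elastic coefficient of the cable -/
  kc : ℝ
  /-- nominal length of the cable -/
  len : ℝ
  /-- gravitational constant -/
  grav : ℝ

/-- The state: positions and velocities of the human handle and of the robot. -/
abbrev State : Type := E3 × E3 × E3 × E3

/-- human position -/
def State.pH (x : State) : E3 := x.1
/-- human velocity -/
def State.vH (x : State) : E3 := x.2.1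
/-- robot position -/
def State.pR (x : State) : E3 := x.2.2.1
/-- robot velocity -/
def State.vR (x : State) : E3 := x.2.2.2

/-- The state space: the human stands on the horizontal ground through the origin and moves along
it, the robot is unconstrained. -/
def stateSet : Set State := {x | inner ℝ zW x.pH = 0 ∧ inner ℝ zW x.vH = 0}

/-- Intensity of the internal force of the cable, a unilateral spring. -/
def tension (P : Params) (l : E3) : ℝ :=
  if 0 < ‖l‖ - P.len then P.kc * (‖l‖ - P.len) else 0

/-- Force that the cable applies to the human. -/
def cableForce (P : Params) (x : State) : E3 :=
  tension P (x.pR - x.pH) • (‖x.pR - x.pH‖⁻¹ • (x.pR - x.pH))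

/-- Weight of the human, written as the upward vector `m_H g z_W`. -/
def weight (P : Params) : E3 := (P.mH * P.grav) • zW

/-- Ground reaction force: the vertical force that balances the vertical components of all the
other forces on the human, so that the human has no vertical acceleration. -/
def groundReaction (P : Params) (x : State) : E3 :=
  (-(inner ℝ zW (-weight P - act P.DH x.vH + cableForce P x))) • zW

/-- Right-hand side of the state dynamics, for the additional robot input `u`. -/
def dynamics (P : Params) (x : State) (u : E3) : State :=
  (x.vH,
   P.mH⁻¹ • (-weight P - act P.DH x.vH + cableForce P x + groundReaction P x),
   x.vR,
   act P.MA⁻¹ (-act P.DA x.vR - cableForce P x + u))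

/-- The gain matrix `diag(k, k, 0)`. -/
def gainMatrix (k : ℝ) : Matrix (Fin 3) (Fin 3) ℝ := Matrix.diagonal ![k, k, 0]

/-- The constant forcing input `f_z z_W`. -/
def forceRef (fz : ℝ) : E3 := fz • zW

/-- The robot reference position associated with the human reference position `pHr`. -/
def robotRef (P : Params) (fz : ℝ) (pHr : E3) : E3 :=
  pHr + (1 / P.kc + P.len / ‖forceRef fz‖) • forceRef fz

/-- The position-based control law `K_p e_R + f_ref`. -/
def controlPos (P : Params) (kp fz : ℝ) (pHr : E3) (x : State) : E3 :=
  act (gainMatrix kp) (robotRef P fz pHr - x.pR) + forceRef fz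

/-- The control law with human velocity feedback, `K_p e_R + f_ref + D_A v_H`. -/
def controlVel (P : Params) (kp fz : ℝ) (pHr : E3) (x : State) : E3 :=
  controlPos P kp fz pHr x + act P.DA x.vH

/-- The vector field of the closed loop under the control law with velocity feedback. -/
def closedLoop (P : Params) (kp fz : ℝ) (pHr : E3) (x : State) : State :=
  dynamics P x (controlVel P kp fz pHr x)

/-- The zero velocity state at the two reference positions. -/
def equilibriumState (P : Params) (fz : ℝ) (pHr : E3) : State :=
  (pHr, 0, robotRef P fz pHr, 0)

end TetheredGuide

/-- `φ` solves `φ' = F φ` on the time set `I`, with values in `X`. -/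
def IsSolutionOn {E : Type*} [NormedAddCommGroup E] [NormedSpace ℝ E]
    (F : E → E) (X : Set E) (φ : ℝ → E) (I : Set ℝ) : Prop :=
  ∀ t ∈ I, φ t ∈ X ∧ HasDerivWithinAt φ (F (φ t)) I t

/-- Lyapunov stability of the point `xe` for `x' = F x` on `X`, over solutions on every bounded
time interval (and hence over solutions on `[0, ∞)`). -/
def IsStableAt {E : Type*} [NormedAddCommGroup E] [NormedSpace ℝ E]
    (F : E → E) (X : Set E) (xe : E) : Prop :=
  ∀ ε > 0, ∃ δ > 0, ∀ T > 0, ∀ φ : ℝ → E, IsSolutionOn F X φ (Set.Icc 0 T) →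
    ‖φ 0 - xe‖ < δ → ∀ t ∈ Set.Icc 0 T, ‖φ t - xe‖ < ε

/-- Local attractivity of `xe`: every initial state in `X` near `xe` is the start of a solution
in `X` on `[0, ∞)`, and every such solution converges to `xe`. -/
def IsLocallyAttractiveAt {E : Type*} [NormedAddCommGroup E] [NormedSpace ℝ E]
    (F : E → E) (X : Set E) (xe : E) : Prop :=
  ∃ r > 0, ∀ x₀ ∈ X, ‖x₀ - xe‖ < r →
    (∃ φ : ℝ → E, IsSolutionOn F X φ (Set.Ici 0) ∧ φ 0 = x₀) ∧
    ∀ φ : ℝ → E, IsSolutionOn F X φ (Set.Ici 0) → φ 0 = x₀ →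
      Filter.Tendsto φ Filter.atTop (nhds xe)

/-- `xe` is an asymptotically stable equilibrium of `x' = F x` on the state space `X`. -/
def IsAsymptoticallyStableEquilibrium {E : Type*} [NormedAddCommGroup E] [NormedSpace ℝ E]
    (F : E → E) (X : Set E) (xe : E) : Prop :=
  xe ∈ X ∧ F xe = 0 ∧ IsStableAt F X xe ∧ IsLocallyAttractiveAt F X xe

end

open Set Filter Topology Matrix

/-! Near `xe` the cable is taut, so the vector field is smooth there, and energy is a natural
Lyapunov candidate: kinetic energy, the spring of `K_p`, and the elastic energy of the cable less
the work of `f_ref`. Weight, ground reaction and `f_ref` are vertical and do no work on the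
horizontally moving human. Along solutions the energy therefore loses exactly v·D_H v + w·D_A w −
w·D_A v, with v, w the velocities of human and robot. Completing the square turns this into v·(D_H −
D_A/4)v + (w − v/2)·D_A(w − v/2), which is positive definite by hypothesis
(`exists_le_dissipation`).

This loss controls only the velocities. Instead of an invariance argument, a small multiple ε of the
pairing of position errors with momenta is added. Its derivative contributes minus the work of the
restoring forces on the position errors, and that work is coercive: the taut cable force is strongly
monotone about the equilibrium span (`le_inner_cable_force`), and although `K_p` ignores the
vertical, the cable controls the vertical robot error because the human error is horizontal
(`exists_le_spring_energy`). For small ε the modified energy is a strict Lyapunov function with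
quadratic bounds, and so decays exponentially. The same bounds trap solutions near `xe`, which lets
local solutions be continued for all time. -/

/-- `W` is a strict Lyapunov function with quadratic bounds for `x' = F x` on `X`, on the ball of
radius `r` about `xe`; `W'` is its derivative along solutions. -/
structure IsQuadraticLyapunov {E : Type*} [NormedAddCommGroup E] [NormedSpace ℝ E]
    (F : E → E) (X : Set E) (xe : E) (W W' : E → ℝ) (a b c r : ℝ) : Prop where
  a_pos : 0 < a
  b_pos : 0 < b
  c_pos : 0 < c
  r_pos : 0 < r
  lower : ∀ x ∈ X, ‖x - xe‖ < r → a * ‖x - xe‖ ^ 2 ≤ W x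
  upper : ∀ x ∈ X, ‖x - xe‖ < r → W x ≤ b * ‖x - xe‖ ^ 2
  deriv : ∀ (φ : ℝ → E) (s : Set ℝ) (t : ℝ), φ t ∈ X → ‖φ t - xe‖ < r →
    HasDerivWithinAt φ (F (φ t)) s t → HasDerivWithinAt (fun u => W (φ u)) (W' (φ t)) s t
  decay : ∀ x ∈ X, ‖x - xe‖ < r → W' x ≤ -(c * ‖x - xe‖ ^ 2)

/-! ### Gluing and uniqueness of solutions -/

section Solutions

variable {E : Type*} [NormedAddCommGroup E] [NormedSpace ℝ E] {F : E → E} {X : Set E} {xe : E}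

theorem IsSolutionOn.mono {φ : ℝ → E} {I J : Set ℝ} (h : IsSolutionOn F X φ I) (hJ : J ⊆ I) :
    IsSolutionOn F X φ J :=
  fun t ht => ⟨(h t (hJ ht)).1, (h t (hJ ht)).2.mono hJ⟩

theorem IsSolutionOn.continuousOn {φ : ℝ → E} {I : Set ℝ} (h : IsSolutionOn F X φ I) :
    ContinuousOn φ I :=
  fun t ht => (h t ht).2.continuousWithinAt

theorem hasDerivWithinAt_Ici_of_Icc {φ : ℝ → E} {d : E} {t T : ℝ} (ht : t ∈ Ico 0 T)
    (h : HasDerivWithinAt φ d (Icc 0 T) t) : HasDerivWithinAt φ d (Ici t) t := by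
  refine h.mono_of_mem_nhdsWithin ?_
  exact mem_of_superset (Icc_mem_nhdsGE ht.2) (Icc_subset_Icc_left ht.1)

/-- Two solutions in a set where the vector field is Lipschitz agree if they start together. -/
theorem IsSolutionOn.eq_of_lipschitzOnWith {φ ψ : ℝ → E} {s : Set E} {K : NNReal} {T : ℝ}
    (hK : LipschitzOnWith K F s) (hφ : IsSolutionOn F X φ (Icc 0 T))
    (hψ : IsSolutionOn F X ψ (Icc 0 T)) (hφs : ∀ t ∈ Icc 0 T, φ t ∈ s)
    (hψs : ∀ t ∈ Icc 0 T, ψ t ∈ s) (h0 : φ 0 = ψ 0) : EqOn φ ψ (Icc 0 T) :=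
  ODE_solution_unique_of_mem_Icc_right (v := fun _ => F) (s := fun _ => s) (fun _ _ => hK)
    hφ.continuousOn
    (fun t ht => hasDerivWithinAt_Ici_of_Icc ht (hφ t (Ico_subset_Icc_self ht)).2)
    (fun t ht => hφs t (Ico_subset_Icc_self ht)) hψ.continuousOn
    (fun t ht => hasDerivWithinAt_Ici_of_Icc ht (hψ t (Ico_subset_Icc_self ht)).2)
    (fun t ht => hψs t (Ico_subset_Icc_self ht)) h0

/-- Concatenation of two solutions on adjacent time intervals. -/
theorem IsSolutionOn.concat {φ ψ : ℝ → E} {S T : ℝ} (hS : 0 ≤ S) (hST : S ≤ T)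
    (hφ : IsSolutionOn F X φ (Icc 0 S)) (hψ : IsSolutionOn F X ψ (Icc S T)) (h : φ S = ψ S) :
    IsSolutionOn F X (fun t => if t ≤ S then φ t else ψ t) (Icc 0 T) := by
  set χ : ℝ → E := fun t => if t ≤ S then φ t else ψ t with hχ
  have e1 : ∀ t ∈ Icc 0 S, χ t = φ t := fun t ht => if_pos ht.2
  have e2 : ∀ t ∈ Icc S T, χ t = ψ t := by
    intro t ht
    rcases ht.1.eq_or_lt with rfl | hlt
    · rw [hχ]; simp [h]
    · exact if_neg (not_le.2 hlt)
  have k1 : ∀ t ∈ Icc 0 S, χ t ∈ X ∧ HasDerivWithinAt χ (F (χ t)) (Icc 0 S) t := by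
    intro t ht
    rw [e1 t ht]
    exact ⟨(hφ t ht).1, (hφ t ht).2.congr e1 (e1 t ht)⟩
  have k2 : ∀ t ∈ Icc S T, χ t ∈ X ∧ HasDerivWithinAt χ (F (χ t)) (Icc S T) t := by
    intro t ht
    rw [e2 t ht]
    exact ⟨(hψ t ht).1, (hψ t ht).2.congr e2 (e2 t ht)⟩
  intro t ht
  rw [← Icc_union_Icc_eq_Icc hS hST] at ht ⊢
  -- Off a closed piece the derivative within it holds vacuously, so the derivative within the union
  -- needs no case split at the junction.
  have n1 : t ∉ Icc 0 S → HasDerivWithinAt χ (F (χ t)) (Icc 0 S) t := fun hn =>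
    HasFDerivWithinAt.of_notMem_closure (by rwa [isClosed_Icc.closure_eq])
  have n2 : t ∉ Icc S T → HasDerivWithinAt χ (F (χ t)) (Icc S T) t := fun hn =>
    HasFDerivWithinAt.of_notMem_closure (by rwa [isClosed_Icc.closure_eq])
  refine ⟨ht.elim (fun h => (k1 t h).1) (fun h => (k2 t h).1), HasDerivWithinAt.union ?_ ?_⟩
  · by_cases hm : t ∈ Icc 0 S
    exacts [(k1 t hm).2, n1 hm]
  · by_cases hm : t ∈ Icc S T
    exacts [(k2 t hm).2, n2 hm]

/-- Solutions on all intervals `[0, n τ]` that remain in a set where the vector field is Lipschitz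
fit together to a solution on `[0, ∞)`. -/
theorem exists_isSolutionOn_Ici {s : Set E} {K : NNReal} {x₀ : E} {τ : ℝ} (hτ : 0 < τ)
    (hK : LipschitzOnWith K F s)
    (h : ∀ n : ℕ, ∃ φ : ℝ → E, φ 0 = x₀ ∧ IsSolutionOn F X φ (Icc 0 (n * τ)) ∧
      ∀ t ∈ Icc 0 (n * τ), φ t ∈ s) :
    ∃ φ : ℝ → E, IsSolutionOn F X φ (Ici 0) ∧ φ 0 = x₀ := by
  choose φ h0 hsol hs using h
  have huniq : ∀ m n : ℕ, ∀ t, 0 ≤ t → t ≤ m * τ → t ≤ n * τ → φ m t = φ n t := by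
    intro m n t ht hm hn
    exact ((hsol m).mono (Icc_subset_Icc_right hm)).eq_of_lipschitzOnWith hK
      ((hsol n).mono (Icc_subset_Icc_right hn))
      (fun u hu => hs m u (Icc_subset_Icc_right hm hu))
      (fun u hu => hs n u (Icc_subset_Icc_right hn hu)) ((h0 m).trans (h0 n).symm)
      (right_mem_Icc.2 ht)
  have hN : ∀ t : ℝ, t ≤ (⌈t / τ⌉₊ : ℝ) * τ := fun t =>
    (div_le_iff₀ hτ).1 (Nat.le_ceil _)
  refine ⟨fun t => φ ⌈t / τ⌉₊ t, fun t ht => ?_, h0 _⟩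
  have ht0 : (0 : ℝ) ≤ t := ht
  -- The shift by 1 keeps `t` away from the right end of `[0, N τ]`, which is then a neighbourhood
  -- of `t` within `[0, ∞)`.
  set N := ⌈(t + 1) / τ⌉₊ with hNdef
  have hN1 : t + 1 ≤ N * τ := hN (t + 1)
  have heq : ∀ u ∈ Icc 0 (N * τ), φ ⌈u / τ⌉₊ u = φ N u := fun u hu =>
    huniq _ _ u hu.1 (hN u) hu.2
  have htN : t ∈ Icc 0 (N * τ) := ⟨ht0, by linarith⟩
  have hnhds : Icc 0 (N * τ) ∈ 𝓝[Ici 0] t := by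
    have : Iic (N * τ) ∈ 𝓝 t := Iic_mem_nhds (by linarith)
    exact mem_nhdsWithin.2 ⟨Iio (N * τ), isOpen_Iio, by simp; linarith,
      fun u hu => ⟨hu.2, le_of_lt hu.1⟩⟩
  have hd := (hsol N t htN)
  simp only [heq t htN]
  exact ⟨hd.1, (hd.2.congr heq (heq t htN)).mono_of_mem_nhdsWithin hnhds⟩

end Solutions

/-! ### Stability and attraction from a quadratic Lyapunov function -/

namespace IsQuadraticLyapunov

variable {E : Type*} [NormedAddCommGroup E] [NormedSpace ℝ E] {F : E → E} {X : Set E} {xe : E}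
  {W W' : E → ℝ} {a b c r : ℝ}

/-- The decay and upper bounds combine to `W' ≤ -(c / b) W`, so `exp (c t / b) * W` does not
increase. -/
theorem le_exp_mul (h : IsQuadraticLyapunov F X xe W W' a b c r) {φ : ℝ → E} {T : ℝ}
    (hφ : IsSolutionOn F X φ (Icc 0 T)) (hr : ∀ t ∈ Icc 0 T, ‖φ t - xe‖ < r) (hT : 0 ≤ T) :
    W (φ T) ≤ Real.exp (-(c / b * T)) * W (φ 0) := by
  have hd : ∀ t ∈ Icc 0 T, HasDerivWithinAt (fun u => Real.exp (c / b * u) * W (φ u))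
      (Real.exp (c / b * t) * (c / b) * W (φ t) + Real.exp (c / b * t) * W' (φ t))
      (Icc 0 T) t := by
    intro t ht
    have h1 := h.deriv φ (Icc 0 T) t (hφ t ht).1 (hr t ht) (hφ t ht).2
    have h2 : HasDerivWithinAt (fun u => Real.exp (c / b * u)) (Real.exp (c / b * t) * (c / b))
        (Icc 0 T) t := by
      have := ((hasDerivAt_id t).const_mul (c / b)).exp
      simpa using this.hasDerivWithinAt
    exact h2.mul h1
  have key := image_le_of_deriv_right_le_deriv_boundary
    (B := fun _ => Real.exp (c / b * 0) * W (φ 0)) (B' := fun _ => 0)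
    (fun t ht => (hd t ht).continuousWithinAt)
    (fun t ht => hasDerivWithinAt_Ici_of_Icc ht (hd t (Ico_subset_Icc_self ht))) le_rfl
    continuousOn_const (fun t _ => hasDerivWithinAt_const _ _ _) (by
      intro t ht
      have ht' := Ico_subset_Icc_self ht
      have h1 := h.upper _ (hφ t ht').1 (hr t ht')
      have h2 := h.decay _ (hφ t ht').1 (hr t ht')
      have h3 : c / b * W (φ t) ≤ c * ‖φ t - xe‖ ^ 2 := by
        rw [div_mul_eq_mul_div, div_le_iff₀ h.b_pos]
        nlinarith [h.c_pos]
      have h4 := Real.exp_pos (c / b * t)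
      nlinarith) (right_mem_Icc.2 hT)
  simp only [mul_zero, Real.exp_zero, one_mul] at key
  rw [Real.exp_neg, inv_mul_eq_div, le_div_iff₀ (Real.exp_pos _), mul_comm]
  exact key

theorem nonneg (h : IsQuadraticLyapunov F X xe W W' a b c r) {x : E} (hx : x ∈ X)
    (hr : ‖x - xe‖ < r) : 0 ≤ W x :=
  (mul_nonneg h.a_pos.le (sq_nonneg _)).trans (h.lower x hx hr)

theorem le_of_isSolutionOn (h : IsQuadraticLyapunov F X xe W W' a b c r) {φ : ℝ → E} {T : ℝ}
    (hφ : IsSolutionOn F X φ (Icc 0 T)) (hr : ∀ t ∈ Icc 0 T, ‖φ t - xe‖ < r) (hT : 0 ≤ T) :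
    W (φ T) ≤ W (φ 0) := by
  refine (h.le_exp_mul hφ hr hT).trans (mul_le_of_le_one_left
    (h.nonneg (hφ 0 (left_mem_Icc.2 hT)).1 (hr 0 (left_mem_Icc.2 hT))) ?_)
  rw [Real.exp_le_one_iff]
  have := h.b_pos
  have := h.c_pos
  have : 0 ≤ c / b * T := by positivity
  linarith

/-- At the first time the error reaches `ε`, the lower bound forces `W ≥ a ε²`, while `W` has not
grown beyond its initial value, which is below `b δ²`. -/
theorem exists_forall_norm_lt (h : IsQuadraticLyapunov F X xe W W' a b c r) {ε : ℝ} (hε : 0 < ε)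
    (hεr : ε < r) : ∃ δ > 0, δ ≤ ε ∧ ∀ T ≥ 0, ∀ φ : ℝ → E, IsSolutionOn F X φ (Icc 0 T) →
      ‖φ 0 - xe‖ < δ → ∀ t ∈ Icc 0 T, ‖φ t - xe‖ < ε := by
  have ha := h.a_pos
  have hb := h.b_pos
  -- Since `k ≤ 1`, `b k² ≤ b k ≤ a`, so no square root is needed.
  set k := min 1 (a / b) with hk
  have hk0 : 0 < k := by positivity
  have hk1 : k ≤ 1 := min_le_left _ _
  have hk2 : b * k ≤ a := by
    have := min_le_right 1 (a / b)
    rw [← hk, le_div_iff₀ hb] at this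
    linarith
  refine ⟨ε * k, by positivity, mul_le_of_le_one_right hε.le hk1, ?_⟩
  intro T hT φ hφ h0 t ht
  by_contra! hcon
  have hδε : ε * k ≤ ε := mul_le_of_le_one_right hε.le hk1
  have hcont : ContinuousOn (fun u => ‖φ u - xe‖) (Icc 0 T) :=
    (hφ.continuousOn.sub continuousOn_const).norm
  have hZ : IsCompact (Icc 0 T ∩ (fun u => ‖φ u - xe‖) ⁻¹' {ε}) :=
    isCompact_Icc.of_isClosed_subset (hcont.preimage_isClosed_of_isClosed isClosed_Icc
      isClosed_singleton) inter_subset_left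
  have hivt : ∀ u ∈ Icc 0 T, ε ≤ ‖φ u - xe‖ → ∃ v ∈ Icc 0 u, ‖φ v - xe‖ = ε := by
    intro u hu hle
    exact intermediate_value_Icc hu.1 (hcont.mono (Icc_subset_Icc_right hu.2))
      ⟨by linarith, hle⟩
  obtain ⟨v, hv, hve⟩ := hivt t ht hcon
  obtain ⟨s, ⟨hs, hse⟩, hmin⟩ := hZ.exists_isLeast ⟨v, ⟨hv.1, hv.2.trans ht.2⟩, hve⟩
  have hse' : ‖φ s - xe‖ = ε := hse
  -- The Lyapunov bounds hold only in the ball of radius `r`; leaving it before `s` would mean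
  -- crossing level `ε` earlier.
  have hball : ∀ u ∈ Icc 0 s, ‖φ u - xe‖ < r := by
    intro u hu
    by_contra! hur
    have huT : u ∈ Icc 0 T := ⟨hu.1, hu.2.trans hs.2⟩
    obtain ⟨w, hw, hwe⟩ := hivt u huT (by linarith)
    have h1 : s ≤ w := hmin ⟨⟨hw.1, hw.2.trans huT.2⟩, hwe⟩
    have h2 : u = s := le_antisymm hu.2 (h1.trans hw.2)
    rw [h2, hse'] at hur
    linarith
  have hW := h.le_of_isSolutionOn (hφ.mono (Icc_subset_Icc_right hs.2)) hball hs.1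
  have hl := h.lower _ (hφ s hs).1 (by linarith)
  have hu := h.upper _ (hφ 0 (left_mem_Icc.2 hT)).1 (by linarith)
  rw [hse'] at hl
  have h3 : ‖φ 0 - xe‖ ^ 2 < (ε * k) ^ 2 := by
    have := norm_nonneg (φ 0 - xe)
    gcongr
  have h4 : b * (ε * k) ^ 2 ≤ a * ε ^ 2 := by
    have : b * k * k ≤ a := by nlinarith
    nlinarith [sq_nonneg ε]
  nlinarith

theorem isStableAt (h : IsQuadraticLyapunov F X xe W W' a b c r) : IsStableAt F X xe := by
  intro ε hε
  have hr := h.r_pos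
  obtain ⟨δ, hδ, -, H⟩ := h.exists_forall_norm_lt (ε := min ε (r / 2)) (by positivity)
    ((min_le_right _ _).trans_lt (by linarith))
  exact ⟨δ, hδ, fun T hT φ hφ h0 t ht => (H T hT.le φ hφ h0 t ht).trans_le (min_le_left _ _)⟩

theorem tendsto (h : IsQuadraticLyapunov F X xe W W' a b c r) {φ : ℝ → E}
    (hφ : IsSolutionOn F X φ (Ici 0)) (hr : ∀ t ≥ 0, ‖φ t - xe‖ < r) :
    Tendsto φ atTop (𝓝 xe) := by
  have ha := h.a_pos
  have hcb : 0 < c / b := div_pos h.c_pos h.b_pos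
  have hbound : ∀ t ≥ 0, ‖φ t - xe‖ ^ 2 ≤ a⁻¹ * (Real.exp (-(c / b * t)) * W (φ 0)) := by
    intro t ht
    have h1 := h.le_exp_mul (hφ.mono (fun u (hu : u ∈ Icc 0 t) => hu.1)) (fun u hu => hr u hu.1) ht
    have h2 := h.lower _ (hφ t ht).1 (hr t ht)
    rw [inv_mul_eq_div, le_div_iff₀ ha]
    linarith
  have hlim : Tendsto (fun t : ℝ => a⁻¹ * (Real.exp (-(c / b * t)) * W (φ 0))) atTop (𝓝 0) := by
    have h1 : Tendsto (fun t : ℝ => c / b * t) atTop atTop := tendsto_id.const_mul_atTop hcb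
    have h2 := Real.tendsto_exp_neg_atTop_nhds_zero.comp h1
    simpa using (h2.mul_const (W (φ 0))).const_mul a⁻¹
  have hsq : Tendsto (fun t => ‖φ t - xe‖ ^ 2) atTop (𝓝 0) :=
    tendsto_of_tendsto_of_tendsto_of_le_of_le' tendsto_const_nhds hlim
      (Eventually.of_forall fun t => sq_nonneg _)
      ((eventually_ge_atTop 0).mono hbound)
  rw [tendsto_iff_norm_sub_tendsto_zero]
  have := hsq.sqrt
  simpa using this

/-- Starts in a fixed ball about `xe` share an existence time, and stability keeps solutions in that
ball, so continuation never stalls. As `X` need not be open, existence is obtained in the whole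
space and `hinv` returns the solution to `X`. -/
theorem isLocallyAttractiveAt [CompleteSpace E] (h : IsQuadraticLyapunov F X xe W W' a b c r)
    (hF : ContDiffAt ℝ 1 F xe)
    (hinv : ∀ (φ : ℝ → E) (T : ℝ), 0 ≤ T → IsSolutionOn F univ φ (Icc 0 T) → φ 0 ∈ X →
      IsSolutionOn F X φ (Icc 0 T)) :
    IsLocallyAttractiveAt F X xe := by
  obtain ⟨K, s, hs, hK⟩ := hF.exists_lipschitzOnWith
  obtain ⟨ρ, hρ, hρs⟩ := Metric.mem_nhds_iff.1 hs
  obtain ⟨r₁, hr₁, η, hη, hex⟩ :=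
    hF.exists_forall_mem_closedBall_exists_eq_forall_mem_Ioo_hasDerivAt 0
  have hr := h.r_pos
  set ε := min (r / 2) (min r₁ ρ) with hεdef
  have hε : 0 < ε := by positivity
  have hεr : ε < r := (min_le_left _ _).trans_lt (by linarith)
  have hεr₁ : ε ≤ r₁ := (min_le_right _ _).trans (min_le_left _ _)
  have hερ : ε ≤ ρ := (min_le_right _ _).trans (min_le_right _ _)
  obtain ⟨δ, hδ, hδε, H⟩ := h.exists_forall_norm_lt hε hεr
  refine ⟨δ, hδ, fun x₀ hx₀ hx₀δ => ⟨?_, ?_⟩⟩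
  -- Local solutions live on an open interval of radius `η`; the closed step `η / 2` fits inside.
  · have hτ : 0 < η / 2 := by linarith
    refine exists_isSolutionOn_Ici hτ (hK.mono hρs) fun n => ?_
    suffices hn : ∃ φ : ℝ → E, φ 0 = x₀ ∧ IsSolutionOn F univ φ (Icc 0 (n * (η / 2))) by
      obtain ⟨φ, h0, hφ⟩ := hn
      have hT : 0 ≤ (n : ℝ) * (η / 2) := by positivity
      have hφX := hinv φ _ hT hφ (h0 ▸ hx₀)
      refine ⟨φ, h0, hφX, fun t ht => ?_⟩
      rw [mem_ball_iff_norm]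
      exact (H _ hT φ hφX (h0 ▸ hx₀δ) t ht).trans_le hερ
    induction n with
    | zero =>
      obtain ⟨α, hα0, hα⟩ := hex x₀ (by
        rw [mem_closedBall_iff_norm]; linarith)
      refine ⟨α, hα0, fun t ht => ⟨mem_univ _, (hα t ?_).hasDerivWithinAt⟩⟩
      simp only [CharP.cast_eq_zero, zero_mul, Icc_self, mem_singleton_iff] at ht
      constructor <;> linarith
    | succ n ih =>
      obtain ⟨φ, h0, hφ⟩ := ih
      set T := (n : ℝ) * (η / 2) with hTdef
      have hT : 0 ≤ T := by positivity
      have hφX := hinv φ _ hT hφ (h0 ▸ hx₀)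
      have hTε := H _ hT φ hφX (h0 ▸ hx₀δ) T (right_mem_Icc.2 hT)
      obtain ⟨α, hα0, hα⟩ := hex (φ T) (by
        rw [mem_closedBall_iff_norm]; linarith)
      have hcast : ((n + 1 : ℕ) : ℝ) * (η / 2) = T + η / 2 := by push_cast; ring
      rw [hcast]
      refine ⟨_, ?_, hφ.concat (ψ := fun t => α (t - T)) hT (by linarith) ?_ (by simp [hα0])⟩
      · simp [hT, h0]
      · intro t ht
        refine ⟨mem_univ _, HasDerivAt.hasDerivWithinAt ?_⟩
        have := hα (t - T) ⟨by linarith [ht.1], by linarith [ht.2]⟩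
        exact this.comp_sub_const t T
  · intro φ hφ h0
    refine h.tendsto hφ fun t ht => ?_
    exact (H t ht φ (hφ.mono fun u hu => hu.1) (h0 ▸ hx₀δ) t (right_mem_Icc.2 ht)).trans hεr

end IsQuadraticLyapunov

/-! ### Energy and force of a taut cable -/

section CableEnergy

variable {V : Type*} [NormedAddCommGroup V] [InnerProductSpace ℝ V]

theorem norm_sub_smul_unit_sq (l n : V) (hn : ‖n‖ = 1) (R : ℝ) :
    ‖l - R • n‖ ^ 2 = (‖l‖ - R) ^ 2 + 2 * R * (‖l‖ - inner ℝ n l) := by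
  rw [norm_sub_sq_real, norm_smul, hn, inner_smul_right, real_inner_comm, mul_one,
    Real.norm_eq_abs, sq_abs]
  ring

theorem norm_sub_sq_le (v w : V) : ‖v - w‖ ^ 2 ≤ 2 * ‖v‖ ^ 2 + 2 * ‖w‖ ^ 2 := by
  have := parallelogram_law_with_norm ℝ v w
  nlinarith [sq_nonneg ‖v + w‖]

theorem inner_unit_le_norm (l n : V) (hn : ‖n‖ = 1) : inner ℝ n l ≤ ‖l‖ := by
  simpa [hn] using real_inner_le_norm n l

/-- Energy of a taut elastic cable with span `l` under the constant force `(k * (R - L)) • n`,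
normalized to vanish at `l = R • n`. -/
noncomputable def cableEnergy (k L R : ℝ) (n l : V) : ℝ :=
  k / 2 * (‖l‖ - L) ^ 2 - k * (R - L) * inner ℝ n l
    - (k / 2 * (R - L) ^ 2 - k * (R - L) * R)

/-- Separates the radial error from the misalignment `‖l‖ - ⟪n, l⟫`, the same two quantities that
make up `‖l - R • n‖ ^ 2` in `norm_sub_smul_unit_sq`; quadratic bounds follow by comparing
coefficients. -/
theorem cableEnergy_eq (k L R : ℝ) (n l : V) :
    cableEnergy k L R n l
      = k / 2 * (‖l‖ - R) ^ 2 + k * (R - L) * (‖l‖ - inner ℝ n l) := by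
  unfold cableEnergy
  ring

theorem le_cableEnergy {k L R : ℝ} (hk : 0 < k) (hL : 0 < L) (hR : L < R) {n : V}
    (hn : ‖n‖ = 1) (l : V) :
    k * (R - L) / (2 * R) * ‖l - R • n‖ ^ 2 ≤ cableEnergy k L R n l := by
  have hR0 : 0 < R := hL.trans hR
  rw [cableEnergy_eq, norm_sub_smul_unit_sq l n hn]
  have h1 : k * (R - L) / (2 * R) ≤ k / 2 := by
    rw [div_le_div_iff₀ (by positivity) (by positivity)]
    nlinarith [mul_pos hk hL]
  have h2 : k * (R - L) / (2 * R) * (2 * R * (‖l‖ - inner ℝ n l))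
      = k * (R - L) * (‖l‖ - inner ℝ n l) := by
    field_simp
  rw [mul_add, h2]
  gcongr

theorem cableEnergy_le {k L R : ℝ} (hk : 0 < k) (hL : 0 < L) {n : V}
    (hn : ‖n‖ = 1) (l : V) : cableEnergy k L R n l ≤ k / 2 * ‖l - R • n‖ ^ 2 := by
  rw [cableEnergy_eq, norm_sub_smul_unit_sq l n hn]
  have := mul_nonneg (mul_pos hk hL).le (sub_nonneg.2 (inner_unit_le_norm l n hn))
  nlinarith

/-- The force field of a taut elastic cable is strongly monotone about its equilibrium. -/
theorem le_inner_cable_force {k L R : ℝ} (hk : 0 < k) (hL : 0 < L) (hR : L < R) {n : V}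
    (hn : ‖n‖ = 1) {l : V} (hl : L ≤ ‖l‖) :
    k * (R - L) / (2 * R) * ‖l - R • n‖ ^ 2
      ≤ inner ℝ ((k * (‖l‖ - L)) • (‖l‖⁻¹ • l) - (k * (R - L)) • n) (l - R • n) := by
  have hR0 : 0 < R := hL.trans hR
  have hr : 0 < ‖l‖ := hL.trans_le hl
  -- `u` is the cosine of the angle between `l` and `n`.
  obtain ⟨u, hu⟩ : ∃ u, inner ℝ n l = ‖l‖ * u := ⟨inner ℝ n l / ‖l‖, by field_simp⟩
  have hu1 : u ≤ 1 := by
    have := inner_unit_le_norm l n hn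
    rw [hu] at this
    by_contra! hc
    nlinarith
  have hexp : inner ℝ ((k * (‖l‖ - L)) • (‖l‖⁻¹ • l) - (k * (R - L)) • n) (l - R • n)
      = k * ((‖l‖ - R) ^ 2 + (1 - u) * (2 * ‖l‖ * R - L * (‖l‖ + R))) := by
    simp only [inner_sub_left, inner_sub_right, inner_smul_left, inner_smul_right,
      real_inner_self_eq_norm_sq, hn, real_inner_comm n l, conj_trivial]
    rw [hu]
    field_simp
    ring
  rw [hexp, norm_sub_smul_unit_sq l n hn, hu]
  have h1 : k * (R - L) / (2 * R) * ((‖l‖ - R) ^ 2 + 2 * R * (‖l‖ - ‖l‖ * u))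
      = k * ((R - L) / (2 * R) * (‖l‖ - R) ^ 2 + (R - L) * ‖l‖ * (1 - u)) := by
    field_simp
  rw [h1]
  have h2 : (R - L) / (2 * R) ≤ 1 := by
    rw [div_le_one (by positivity)]
    linarith
  have h3 : (R - L) / (2 * R) * (‖l‖ - R) ^ 2 ≤ (‖l‖ - R) ^ 2 :=
    mul_le_of_le_one_left (sq_nonneg _) h2
  have h4 : 0 ≤ (1 - u) * (R * (‖l‖ - L)) :=
    mul_nonneg (by linarith) (mul_nonneg hR0.le (by linarith))
  -- The two sides differ by `(1 - u) * (R * (‖l‖ - L))`, nonnegative because the cable is not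
  -- slack.
  have h5 : (R - L) * ‖l‖ * (1 - u) ≤ (1 - u) * (2 * ‖l‖ * R - L * (‖l‖ + R)) := by
    nlinarith
  exact mul_le_mul_of_nonneg_left (by linarith) hk.le

/-- A horizontal spring at one end together with a spring between the two ends is a positive
definite coupling, provided that the other end moves horizontally. -/
theorem exists_le_spring_energy {p μ : ℝ} (hp : 0 < p) (hμ : 0 < μ) :
    ∃ m > 0, ∀ z h ρ : V, ‖z‖ = 1 → inner ℝ z h = 0 →
      m * (‖ρ‖ ^ 2 + ‖h‖ ^ 2) ≤ p * (‖ρ‖ ^ 2 - (inner ℝ z ρ) ^ 2) + μ * ‖ρ - h‖ ^ 2 := by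
  set m := min p (μ / 2) with hm
  have hm0 : 0 < m := by positivity
  have hmp : m ≤ p := min_le_left _ _
  have hmμ : m ≤ μ / 2 := min_le_right _ _
  refine ⟨m / 3, by positivity, fun z h ρ hz hzh => ?_⟩
  have key : ∀ w : V, (inner ℝ z w) ^ 2 ≤ ‖w‖ ^ 2 := by
    intro w
    have := abs_real_inner_le_norm z w
    rw [hz, one_mul] at this
    exact sq_le_sq' (by linarith [(abs_le.1 this).1]) (abs_le.1 this).2
  -- As `h` is orthogonal to `z`, the missing `z`-component of `ρ` is that of `ρ - h`, which the
  -- coupling spring controls.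
  have h1 : (inner ℝ z ρ) ^ 2 ≤ ‖ρ - h‖ ^ 2 := by
    have := key (ρ - h)
    rwa [inner_sub_right, hzh, sub_zero] at this
  have h2 := key ρ
  have h3 : ‖h‖ ^ 2 ≤ 2 * ‖ρ‖ ^ 2 + 2 * ‖ρ - h‖ ^ 2 := by
    simpa using norm_sub_sq_le ρ (ρ - h)
  nlinarith [mul_le_mul_of_nonneg_right hmp (sub_nonneg.2 h2),
    mul_le_mul_of_nonneg_right hmμ (sq_nonneg ‖ρ - h‖)]

end CableEnergy

/-! ### Quadratic forms of the damping, inertia and gain matrices -/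

namespace TetheredGuide

theorem act_eq (M : Matrix (Fin 3) (Fin 3) ℝ) (v : E3) :
    act M v = toEuclideanCLM (n := Fin 3) (𝕜 := ℝ) M v := rfl

theorem norm_act_le (M : Matrix (Fin 3) (Fin 3) ℝ) (v : E3) :
    ‖act M v‖ ≤ ‖toEuclideanCLM (n := Fin 3) (𝕜 := ℝ) M‖ * ‖v‖ :=
  ContinuousLinearMap.le_opNorm (toEuclideanCLM (n := Fin 3) (𝕜 := ℝ) M) v

theorem inner_act_eq (M : Matrix (Fin 3) (Fin 3) ℝ) (v w : E3) :
    inner ℝ v (act M w) = v.ofLp ⬝ᵥ M *ᵥ w.ofLp := inner_toEuclideanCLM M v w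

theorem inner_act_comm {M : Matrix (Fin 3) (Fin 3) ℝ} (hM : M.IsHermitian) (v w : E3) :
    inner ℝ v (act M w) = inner ℝ w (act M v) := by
  rw [inner_act_eq, inner_act_eq, dotProduct_mulVec, dotProduct_comm, ← mulVec_transpose]
  have : Mᵀ = M := by simpa [IsHermitian] using hM
  rw [this]

theorem act_act_inv {M : Matrix (Fin 3) (Fin 3) ℝ} (hM : M.PosDef) (v : E3) :
    act M (act M⁻¹ v) = v := by
  have hdet : IsUnit M.det := (Matrix.isUnit_iff_isUnit_det M).1 hM.isUnit
  simp [act, mulVec_mulVec, Matrix.mul_nonsing_inv M hdet]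

/-- The form attains a positive minimum on the compact unit sphere; homogeneity does the rest. -/
theorem exists_le_inner_act {M : Matrix (Fin 3) (Fin 3) ℝ} (hM : M.PosDef) :
    ∃ c > 0, ∀ v : E3, c * ‖v‖ ^ 2 ≤ inner ℝ v (act M v) := by
  have hcont : Continuous fun v : E3 => (inner ℝ v (act M v) : ℝ) := by
    simp only [act_eq]
    fun_prop
  obtain ⟨w, hw, hmin⟩ := (isCompact_sphere (0 : E3) 1).exists_isMinOn
    (NormedSpace.sphere_nonempty.2 zero_le_one) hcont.continuousOn
  have hw1 : ‖w‖ = 1 := by simpa using hw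
  have hpos : 0 < (inner ℝ w (act M w) : ℝ) := by
    rw [inner_act_eq]
    have hw0 : w.ofLp ≠ 0 := by
      intro h0
      have : w = 0 := by ext i; simp [h0]
      rw [this] at hw1
      simp at hw1
    simpa using hM.dotProduct_mulVec_pos hw0
  refine ⟨_, hpos, fun v => ?_⟩
  by_cases hv : v = 0
  · simp [hv]
  have hv0 : 0 < ‖v‖ := norm_pos_iff.2 hv
  have hmem : ‖v‖⁻¹ • v ∈ Metric.sphere (0 : E3) 1 := by
    simp [norm_smul, hv0.ne']
  have h1 : (inner ℝ w (act M w) : ℝ) ≤ inner ℝ (‖v‖⁻¹ • v) (act M (‖v‖⁻¹ • v)) := hmin hmem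
  rw [act_eq, act_eq, map_smul, inner_smul_left, inner_smul_right] at h1
  simp only [conj_trivial] at h1
  rw [act_eq, act_eq]
  calc _ ≤ ‖v‖⁻¹ * (‖v‖⁻¹ * _) * ‖v‖ ^ 2 := mul_le_mul_of_nonneg_right h1 (sq_nonneg _)
    _ = _ := by field_simp

theorem norm_zW : ‖zW‖ = 1 := by
  simp [zW, EuclideanSpace.norm_eq, Fin.sum_univ_three]

theorem inner_zW_zW : inner ℝ zW zW = (1 : ℝ) := by
  rw [real_inner_self_eq_norm_sq, norm_zW, one_pow]

theorem inner_act_gainMatrix (k : ℝ) (v : E3) :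
    inner ℝ v (act (gainMatrix k) v) = k * (‖v‖ ^ 2 - (inner ℝ zW v) ^ 2) := by
  rw [inner_act_eq, EuclideanSpace.norm_sq_eq]
  simp [gainMatrix, zW, mulVec_diagonal, dotProduct, Fin.sum_univ_three, PiLp.inner_apply]
  ring

/-- If `D_H - D_A / 4` is positive definite, the velocity feedback leaves the dissipation
positive definite. -/
theorem exists_le_dissipation {DH DA : Matrix (Fin 3) (Fin 3) ℝ} (hDA : DA.PosDef)
    (hD : (DH - (1 / 4 : ℝ) • DA).PosDef) :
    ∃ d > 0, ∀ v w : E3, d * (‖v‖ ^ 2 + ‖w‖ ^ 2)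
      ≤ inner ℝ v (act DH v) + inner ℝ w (act DA w) - inner ℝ w (act DA v) := by
  obtain ⟨c₁, hc₁, h₁⟩ := exists_le_inner_act hD
  obtain ⟨c₂, hc₂, h₂⟩ := exists_le_inner_act hDA
  set m := min c₁ c₂ with hm
  have hm0 : 0 < m := by positivity
  refine ⟨m / 2, by positivity, fun v w => ?_⟩
  have e₁ := h₁ v
  -- Completing the square in `w` leaves the form of `DH - DA / 4` in `v`.
  have e₂ := h₂ (w - (1 / 2 : ℝ) • v)
  have hs := inner_act_comm hDA.1 v w
  have i₁ : inner ℝ v (act (DH - (1 / 4 : ℝ) • DA) v)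
      = (inner ℝ v (act DH v) : ℝ) - 1 / 4 * inner ℝ v (act DA v) := by
    simp only [act_eq, map_sub, map_smul, _root_.sub_apply,
      _root_.smul_apply, inner_sub_right, inner_smul_right]
  have i₂ : inner ℝ (w - (1 / 2 : ℝ) • v) (act DA (w - (1 / 2 : ℝ) • v))
      = (inner ℝ w (act DA w) : ℝ) - inner ℝ w (act DA v) + 1 / 4 * inner ℝ v (act DA v) := by
    simp only [act_eq] at hs ⊢
    simp only [map_sub, map_smul, inner_sub_left, inner_sub_right, inner_smul_left,
      inner_smul_right, conj_trivial, hs]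
    ring
  have i₃ : ‖w‖ ^ 2 ≤ 2 * ‖w - (1 / 2 : ℝ) • v‖ ^ 2 + 1 / 2 * ‖v‖ ^ 2 := by
    have hpl := parallelogram_law_with_norm ℝ (w - (1 / 2 : ℝ) • v) ((1 / 2 : ℝ) • v)
    rw [sub_add_cancel, norm_smul] at hpl
    have : ‖(1 / 2 : ℝ)‖ = 1 / 2 := by norm_num
    rw [this] at hpl
    nlinarith [sq_nonneg ‖w - (1 / 2 : ℝ) • v - (1 / 2 : ℝ) • v‖]
  have j₁ : m * ‖v‖ ^ 2 ≤ c₁ * ‖v‖ ^ 2 :=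
    mul_le_mul_of_nonneg_right (min_le_left _ _) (sq_nonneg _)
  have j₂ : m * ‖w - (1 / 2 : ℝ) • v‖ ^ 2 ≤ c₂ * ‖w - (1 / 2 : ℝ) • v‖ ^ 2 :=
    mul_le_mul_of_nonneg_right (min_le_right _ _) (sq_nonneg _)
  nlinarith [mul_le_mul_of_nonneg_left i₃ hm0.le, mul_nonneg hm0.le (sq_nonneg ‖v‖)]

end TetheredGuide

/-! ### Differentiating the cable energy -/

section NormDerivative

variable {V : Type*} [NormedAddCommGroup V] [InnerProductSpace ℝ V]

theorem hasDerivWithinAt_norm_of_ne_zero {l : ℝ → V} {l' : V} {s : Set ℝ} {t : ℝ}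
    (h : HasDerivWithinAt l l' s t) (h0 : l t ≠ 0) :
    HasDerivWithinAt (fun u => ‖l u‖) (‖l t‖⁻¹ * inner ℝ (l t) l') s t := by
  have hpos : 0 < ‖l t‖ := norm_pos_iff.2 h0
  have h1 := h.norm_sq.sqrt (by positivity)
  have h2 : (fun u => √(‖l u‖ ^ 2)) = fun u => ‖l u‖ := by
    funext u
    exact Real.sqrt_sq (norm_nonneg _)
  rw [h2] at h1
  refine h1.congr_deriv ?_
  rw [Real.sqrt_sq hpos.le]
  field_simp

theorem hasDerivWithinAt_cableEnergy {l : ℝ → V} {l' : V} {s : Set ℝ} {t : ℝ} (k L R : ℝ) (n : V)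
    (h : HasDerivWithinAt l l' s t) (h0 : l t ≠ 0) :
    HasDerivWithinAt (fun u => cableEnergy k L R n (l u))
      (inner ℝ ((k * (‖l t‖ - L)) • (‖l t‖⁻¹ • l t) - (k * (R - L)) • n) l') s t := by
  unfold cableEnergy
  have h1 := (((hasDerivWithinAt_norm_of_ne_zero h h0).sub_const L).pow 2).const_mul (k / 2)
  have h2 := ((hasDerivWithinAt_const t s n).inner ℝ h).const_mul (k * (R - L))
  refine ((h1.sub h2).sub_const (k / 2 * (R - L) ^ 2 - k * (R - L) * R)).congr_deriv ?_
  simp only [inner_sub_left, inner_smul_left, conj_trivial, inner_zero_left]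
  ring

end NormDerivative

/-! ### Equilibrium, Lyapunov function and invariance for the closed loop -/

namespace TetheredGuide

/-- Length of the cable at the equilibrium. -/
noncomputable def eqLength (P : Params) (fz : ℝ) : ℝ := P.len + |fz| / P.kc

/-- Direction of the cable at the equilibrium, from the human to the robot. -/
noncomputable def eqDir (fz : ℝ) : E3 := (fz / |fz|) • zW

theorem norm_eqDir {fz : ℝ} (hfz : fz ≠ 0) : ‖eqDir fz‖ = 1 := by
  have : |fz| ≠ 0 := abs_ne_zero.2 hfz
  rw [eqDir, norm_smul, norm_zW, norm_div, Real.norm_eq_abs, Real.norm_eq_abs, abs_abs, mul_one,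
    div_self this]

/-- The equilibrium tension is `|fz|` and `eqDir` carries the sign of `fz`, so both signs are
treated at once. -/
theorem smul_eqDir (P : Params) (hkc : 0 < P.kc) {fz : ℝ} (hfz : fz ≠ 0) :
    (P.kc * (eqLength P fz - P.len)) • eqDir fz = forceRef fz := by
  have : |fz| ≠ 0 := abs_ne_zero.2 hfz
  rw [eqLength, eqDir, forceRef, smul_smul]
  congr 1
  field_simp
  ring

theorem robotRef_sub (P : Params) (hkc : 0 < P.kc) {fz : ℝ} (hfz : fz ≠ 0) (pHr : E3) :
    robotRef P fz pHr - pHr = eqLength P fz • eqDir fz := by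
  have : |fz| ≠ 0 := abs_ne_zero.2 hfz
  rw [robotRef, add_sub_cancel_left, eqLength, eqDir, forceRef, norm_smul, norm_zW, smul_smul,
    smul_smul, Real.norm_eq_abs]
  congr 1
  field_simp
  ring

theorem len_lt_eqLength (P : Params) (hkc : 0 < P.kc) {fz : ℝ} (hfz : fz ≠ 0) :
    P.len < eqLength P fz := by
  have : 0 < |fz| := abs_pos.2 hfz
  have : 0 < |fz| / P.kc := by positivity
  rw [eqLength]
  linarith

theorem cableForce_of_taut (P : Params) {x : State} (h : P.len < ‖x.pR - x.pH‖) :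
    cableForce P x
      = (P.kc * (‖x.pR - x.pH‖ - P.len)) • (‖x.pR - x.pH‖⁻¹ • (x.pR - x.pH)) := by
  rw [cableForce, tension, if_pos (sub_pos.2 h)]

theorem inner_zW_closedLoop_vH (P : Params) (kp fz : ℝ) (pHr : E3) (x : State) :
    inner ℝ zW (closedLoop P kp fz pHr x).vH = (0 : ℝ) := by
  simp only [closedLoop, dynamics, State.vH, groundReaction, inner_smul_right, inner_add_right,
    inner_zW_zW]
  ring

/-- Weight and ground reaction are vertical, hence invisible to a horizontal `w`; it is applied to
the human velocity and position error. -/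
theorem mul_inner_closedLoop_vH (P : Params) (hmH : 0 < P.mH) (kp fz : ℝ) (pHr : E3) (x : State)
    {w : E3} (hw : inner ℝ zW w = (0 : ℝ)) :
    P.mH * inner ℝ w (closedLoop P kp fz pHr x).vH
      = -inner ℝ w (act P.DH x.vH) + inner ℝ w (cableForce P x) := by
  have hw' : inner ℝ w zW = (0 : ℝ) := by rw [real_inner_comm, hw]
  simp only [closedLoop, dynamics, State.vH, groundReaction, weight, inner_smul_right,
    inner_add_right, inner_sub_right, inner_neg_right, hw']
  field_simp
  ring

theorem act_MA_closedLoop_vR (P : Params) (hMA : P.MA.PosDef) (kp fz : ℝ) (pHr : E3) (x : State) :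
    act P.MA (closedLoop P kp fz pHr x).vR
      = -act P.DA x.vR - cableForce P x
        + (-act (gainMatrix kp) (x.pR - robotRef P fz pHr) + forceRef fz + act P.DA x.vH) := by
  have : act (gainMatrix kp) (robotRef P fz pHr - x.pR)
      = -act (gainMatrix kp) (x.pR - robotRef P fz pHr) := by
    rw [act_eq, act_eq, ← map_neg, neg_sub]
  rw [← this]
  exact act_act_inv hMA _

/-- Total energy of the closed loop plus a small multiple `ε` of the coupling between position
errors and momenta. -/
noncomputable def lyapunov (P : Params) (kp fz : ℝ) (pHr : E3) (ε : ℝ) (x : State) : ℝ :=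
  P.mH / 2 * ‖x.vH‖ ^ 2 + 1 / 2 * inner ℝ x.vR (act P.MA x.vR)
    + 1 / 2 * inner ℝ (x.pR - robotRef P fz pHr)
        (act (gainMatrix kp) (x.pR - robotRef P fz pHr))
    + cableEnergy P.kc P.len (eqLength P fz) (eqDir fz) (x.pR - x.pH)
    + ε * (P.mH * inner ℝ (x.pH - pHr) x.vH
        + inner ℝ (x.pR - robotRef P fz pHr) (act P.MA x.vR))

/-- The derivative of `lyapunov` along closed-loop solutions. -/
noncomputable def lyapunovDeriv (P : Params) (kp fz : ℝ) (pHr : E3) (ε : ℝ) (x : State) : ℝ :=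
  -(inner ℝ x.vH (act P.DH x.vH) + inner ℝ x.vR (act P.DA x.vR)
      - inner ℝ x.vR (act P.DA x.vH))
    + ε * (P.mH * ‖x.vH‖ ^ 2 + inner ℝ x.vR (act P.MA x.vR)
        - inner ℝ (x.pH - pHr) (act P.DH x.vH)
        - inner ℝ (x.pR - robotRef P fz pHr) (act P.DA x.vR)
        + inner ℝ (x.pR - robotRef P fz pHr) (act P.DA x.vH)
        - inner ℝ (x.pR - robotRef P fz pHr)
            (act (gainMatrix kp) (x.pR - robotRef P fz pHr))
        - inner ℝ (cableForce P x - forceRef fz)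
            ((x.pR - robotRef P fz pHr) - (x.pH - pHr)))

theorem isHermitian_gainMatrix (k : ℝ) : (gainMatrix k).IsHermitian :=
  isHermitian_diagonal _

/-- The powers of the cable, of `K_p` and of `f_ref` cancel between kinetic and potential energy,
leaving the damping and the velocity feedback; the `ε` terms are the virial of the same forces. -/
theorem hasDerivWithinAt_lyapunov (P : Params) (hmH : 0 < P.mH) (hkc : 0 < P.kc)
    (hlen : 0 < P.len) (hMA : P.MA.PosDef) (kp : ℝ) {fz : ℝ} (hfz : fz ≠ 0) {pHr : E3}
    (hpHr : inner ℝ zW pHr = (0 : ℝ)) (ε : ℝ) {φ : ℝ → State} {s : Set ℝ} {t : ℝ}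
    (hX : φ t ∈ stateSet) (htaut : P.len < ‖(φ t).pR - (φ t).pH‖)
    (h : HasDerivWithinAt φ (closedLoop P kp fz pHr (φ t)) s t) :
    HasDerivWithinAt (fun u => lyapunov P kp fz pHr ε (φ u))
      (lyapunovDeriv P kp fz pHr ε (φ t)) s t := by
  set x := φ t with hx
  set y := closedLoop P kp fz pHr x with hy
  have d1 : HasDerivWithinAt (fun u => (φ u).pH) x.vH s t := h.fst
  have d2 : HasDerivWithinAt (fun u => (φ u).vH) y.vH s t := h.snd.fst
  have d3 : HasDerivWithinAt (fun u => (φ u).pR) x.vR s t := h.snd.snd.fst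
  have d4 : HasDerivWithinAt (fun u => (φ u).vR) y.vR s t := h.snd.snd.snd
  have dact : ∀ (M : Matrix (Fin 3) (Fin 3) ℝ) {f : ℝ → E3} {f' : E3},
      HasDerivWithinAt f f' s t → HasDerivWithinAt (fun u => act M (f u)) (act M f') s t := by
    intro M f f' hf
    exact (toEuclideanCLM (n := Fin 3) (𝕜 := ℝ) M).hasFDerivAt.comp_hasDerivWithinAt t hf
  have d5 := d3.sub_const (robotRef P fz pHr)
  have d6 := d1.sub_const pHr
  have hl0 : (φ t).pR - (φ t).pH ≠ 0 := norm_pos_iff.1 (hlen.trans htaut)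
  have e1 := (d2.norm_sq).const_mul (P.mH / 2)
  have e2 := (d4.inner ℝ (dact P.MA d4)).const_mul (1 / 2)
  have e3 := (d5.inner ℝ (dact (gainMatrix kp) d5)).const_mul (1 / 2)
  have e4 := hasDerivWithinAt_cableEnergy P.kc P.len (eqLength P fz) (eqDir fz) (d3.sub d1) hl0
  have e5 := (((d6.inner ℝ d2).const_mul P.mH).add (d5.inner ℝ (dact P.MA d4))).const_mul ε
  refine ((((e1.add e2).add e3).add e4).add e5).congr_deriv ?_
  simp only [← hx, Pi.sub_apply]
  have hvz : inner ℝ zW x.vH = (0 : ℝ) := hX.2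
  have hpz : inner ℝ zW (x.pH - pHr) = (0 : ℝ) := by
    rw [inner_sub_right, hpHr, sub_zero]; exact hX.1
  have m1 := mul_inner_closedLoop_vH P hmH kp fz pHr x hvz
  have m2 := mul_inner_closedLoop_vH P hmH kp fz pHr x hpz
  have m3 := act_MA_closedLoop_vR P hMA kp fz pHr x
  rw [← hy] at m1 m2 m3
  rw [smul_eqDir P hkc hfz, ← cableForce_of_taut P htaut]
  have f1 : inner ℝ (forceRef fz) x.vH = (0 : ℝ) := by
    rw [forceRef, inner_smul_left, hvz, mul_zero]
  have f2 : inner ℝ (forceRef fz) (x.pH - pHr) = (0 : ℝ) := by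
    rw [forceRef, inner_smul_left, hpz, mul_zero]
  have s1 : inner ℝ y.vR (act P.MA x.vR) = (inner ℝ x.vR (act P.MA y.vR) : ℝ) :=
    inner_act_comm hMA.1 _ _
  have s2 := inner_act_comm (isHermitian_gainMatrix kp) x.vR (x.pR - robotRef P fz pHr)
  rw [s1, m3, ← s2]
  unfold lyapunovDeriv
  generalize cableForce P x = T at *
  generalize forceRef fz = f at *
  generalize x.pR - robotRef P fz pHr = ρ at *
  generalize x.pH - pHr = η at *
  generalize act (gainMatrix kp) ρ = Kρ at *
  simp only [inner_sub_left, inner_sub_right, inner_add_right, inner_neg_right, f1, f2,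
    real_inner_self_eq_norm_sq] at *
  rw [real_inner_comm T x.vH] at m1
  rw [real_inner_comm T η] at m2
  rw [real_inner_comm T x.vR, real_inner_comm f x.vR, real_inner_comm T ρ, real_inner_comm f ρ]
  linear_combination m1 + ε * m2

theorem closedLoop_equilibriumState (P : Params) (hkc : 0 < P.kc) (hlen : 0 < P.len) (kp : ℝ)
    {fz : ℝ} (hfz : fz ≠ 0) (pHr : E3) :
    closedLoop P kp fz pHr (equilibriumState P fz pHr) = 0 := by
  have hR := len_lt_eqLength P hkc hfz
  have hR0 : 0 < eqLength P fz := hlen.trans hR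
  have hl : (equilibriumState P fz pHr).pR - (equilibriumState P fz pHr).pH
      = eqLength P fz • eqDir fz := robotRef_sub P hkc hfz pHr
  have hnorm : ‖(equilibriumState P fz pHr).pR - (equilibriumState P fz pHr).pH‖
      = eqLength P fz := by
    rw [hl, norm_smul, norm_eqDir hfz, mul_one, Real.norm_eq_abs, abs_of_pos hR0]
  have hT : cableForce P (equilibriumState P fz pHr) = forceRef fz := by
    rw [cableForce_of_taut P (by rw [hnorm]; exact hR), hnorm, hl, smul_smul (eqLength P fz)⁻¹,
      inv_mul_cancel₀ hR0.ne', one_smul, smul_eqDir P hkc hfz]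
  have act0 : ∀ M, act M 0 = 0 := fun M => by rw [act_eq, map_zero]
  have hv : (equilibriumState P fz pHr).vH = 0 := rfl
  have hw : (equilibriumState P fz pHr).vR = 0 := rfl
  have hp : (equilibriumState P fz pHr).pR = robotRef P fz pHr := rfl
  simp only [closedLoop, dynamics, controlVel, controlPos, groundReaction, hT, hv, hw, hp, act0,
    sub_self]
  ext1
  · rfl
  ext1
  · simp only [weight, forceRef, inner_add_right, inner_sub_right, inner_neg_right,
      inner_smul_right, inner_zW_zW, Prod.fst_zero, Prod.snd_zero, inner_zero_right]
    module
  ext1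
  · rfl
  · simp [act0]

/-- Tautness is an open condition, so the unilateral switch is not seen near `x`, and the norm is
smooth away from zero span. -/
theorem contDiffAt_closedLoop (P : Params) (hlen : 0 < P.len) (kp fz : ℝ) (pHr : E3) {x : State}
    (htaut : P.len < ‖x.pR - x.pH‖) : ContDiffAt ℝ 1 (closedLoop P kp fz pHr) x := by
  have c1 : ContDiff ℝ 1 fun y : State => y.pH := contDiff_fst
  have c2 : ContDiff ℝ 1 fun y : State => y.vH := contDiff_fst.comp contDiff_snd
  have c3 : ContDiff ℝ 1 fun y : State => y.pR :=
    contDiff_fst.comp (contDiff_snd.comp contDiff_snd)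
  have c4 : ContDiff ℝ 1 fun y : State => y.vR :=
    contDiff_snd.comp (contDiff_snd.comp contDiff_snd)
  have hact : ∀ (M : Matrix (Fin 3) (Fin 3) ℝ) {f : State → E3}, ContDiffAt ℝ 1 f x →
      ContDiffAt ℝ 1 (fun y => act M (f y)) x := by
    intro M f hf
    exact (toEuclideanCLM (n := Fin 3) (𝕜 := ℝ) M).contDiff.contDiffAt.comp x hf
  have cl : ContDiffAt ℝ 1 (fun y : State => y.pR - y.pH) x := (c3.sub c1).contDiffAt
  have hl0 : x.pR - x.pH ≠ 0 := norm_pos_iff.1 (hlen.trans htaut)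
  have hn : ContDiffAt ℝ 1 (fun y : State => ‖y.pR - y.pH‖) x := cl.norm ℝ hl0
  have hev : ∀ᶠ y : State in 𝓝 x, P.len < ‖y.pR - y.pH‖ :=
    hn.continuousAt.eventually_const_lt htaut
  have hT : ContDiffAt ℝ 1 (cableForce P) x := by
    have : ContDiffAt ℝ 1 (fun y : State => (P.kc * (‖y.pR - y.pH‖ - P.len)) •
        (‖y.pR - y.pH‖⁻¹ • (y.pR - y.pH))) x :=
      (contDiffAt_const.mul (hn.sub contDiffAt_const)).smul
        ((hn.inv (norm_ne_zero_iff.2 hl0)).smul cl)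
    exact this.congr_of_eventuallyEq (hev.mono fun y hy => cableForce_of_taut P hy)
  have hH : ContDiffAt ℝ 1 (fun y : State => -weight P - act P.DH y.vH + cableForce P y) x :=
    (contDiffAt_const.sub (hact P.DH c2.contDiffAt)).add hT
  have hg : ContDiffAt ℝ 1 (groundReaction P) x :=
    ((contDiffAt_const.inner ℝ hH).neg).smul contDiffAt_const
  have hu : ContDiffAt ℝ 1 (controlVel P kp fz pHr) x :=
    ((hact _ (contDiffAt_const.sub c3.contDiffAt)).add contDiffAt_const).add
      (hact _ c2.contDiffAt)
  exact c2.contDiffAt.prodMk (((hH.add hg).const_smul P.mH⁻¹).prodMk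
    (c4.contDiffAt.prodMk (hact _ ((((hact _ c4.contDiffAt).neg).sub hT).add hu))))

/-- The ground reaction cancels vertical acceleration, so vertical velocity stays zero, and then so
does height. -/
theorem isSolutionOn_stateSet (P : Params) (kp fz : ℝ) (pHr : E3) (φ : ℝ → State) (T : ℝ)
    (hφ : IsSolutionOn (closedLoop P kp fz pHr) univ φ (Icc 0 T)) (h0 : φ 0 ∈ stateSet) :
    IsSolutionOn (closedLoop P kp fz pHr) stateSet φ (Icc 0 T) := by
  have hz : ∀ {f : ℝ → E3} {f' : ℝ → E3},
      (∀ t ∈ Icc 0 T, HasDerivWithinAt f (f' t) (Icc 0 T) t) →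
      (∀ t ∈ Icc 0 T, inner ℝ zW (f' t) = (0 : ℝ)) →
      ∀ t ∈ Icc 0 T, inner ℝ zW (f t) = (inner ℝ zW (f 0) : ℝ) := by
    intro f f' hf hf0
    have hd : ∀ t ∈ Icc 0 T, HasDerivWithinAt (fun u => (inner ℝ zW (f u) : ℝ)) 0 (Icc 0 T) t := by
      intro t ht
      have := (hasDerivWithinAt_const t (Icc 0 T) zW).inner ℝ (hf t ht)
      simpa [hf0 t ht] using this
    exact constant_of_has_deriv_right_zero (fun t ht => (hd t ht).continuousWithinAt)
      fun t ht => hasDerivWithinAt_Ici_of_Icc ht (hd t (Ico_subset_Icc_self ht))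
  have hv : ∀ t ∈ Icc 0 T, inner ℝ zW (φ t).vH = (0 : ℝ) := fun t ht =>
    (hz (f := fun u => (φ u).vH) (f' := fun u => (closedLoop P kp fz pHr (φ u)).vH)
      (fun u hu => (hφ u hu).2.snd.fst)
      (fun u _ => inner_zW_closedLoop_vH P kp fz pHr (φ u)) t ht).trans h0.2
  have hp : ∀ t ∈ Icc 0 T, inner ℝ zW (φ t).pH = (0 : ℝ) := fun t ht =>
    (hz (f := fun u => (φ u).pH) (f' := fun u => (φ u).vH)
      (fun u hu => (hφ u hu).2.fst) hv t ht).trans h0.1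
  exact fun t ht => ⟨⟨hp t ht, hv t ht⟩, (hφ t ht).2⟩

end TetheredGuide

/-! ### Absorbing the cross terms -/

theorem mul_mul_le_add_sq {m : ℝ} (hm : 0 < m) (K x y : ℝ) :
    K * (x * y) ≤ m / 4 * x ^ 2 + K ^ 2 / m * y ^ 2 := by
  have h : m / 4 * x ^ 2 + K ^ 2 / m * y ^ 2 - K * (x * y) = (m / 2 * x - K * y) ^ 2 / m := by
    field_simp
    ring
  have : 0 ≤ (m / 2 * x - K * y) ^ 2 / m := by positivity
  linarith

/-- Damping of the velocities `v, w` absorbs a small multiple of the coupling terms, which in turn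
provide decay in the position errors `h, ρ`. -/
theorem exists_coupling_decay {d m K : ℝ} (hd : 0 < d) (hm : 0 < m) (hK : 0 < K) :
    ∃ ε₀ > 0, ∀ ε > 0, ε ≤ ε₀ → ∃ c > 0, ∀ v w h ρ : ℝ,
      -(d * (v ^ 2 + w ^ 2)) + ε * (K * (v ^ 2 + w ^ 2) + K * (h * v) + K * (ρ * w) + K * (ρ * v)
        - m * (ρ ^ 2 + h ^ 2)) ≤ -(c * (h ^ 2 + v ^ 2 + ρ ^ 2 + w ^ 2)) := by
  -- The factor 2 counts the two products containing `v`. Weights `m / 4` use up at most half of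
  -- `m`, and `ε Q ≤ d / 2` at most half of `d`.
  set Q := K + 2 * (K ^ 2 / m) with hQ
  have hQ0 : 0 < Q := by positivity
  refine ⟨d / (2 * Q), by positivity, fun ε hε hεε => ⟨min (d / 2) (ε * (m / 2)), by positivity,
    fun v w h ρ => ?_⟩⟩
  have h1 := mul_mul_le_add_sq hm K h v
  have h2 := mul_mul_le_add_sq hm K ρ w
  have h3 := mul_mul_le_add_sq hm K ρ v
  have hεQ : ε * Q ≤ d / 2 := by
    rw [le_div_iff₀ (by positivity)] at hεε
    linarith
  have hm2 : 0 ≤ m * h ^ 2 := by positivity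
  have hq2 : 0 ≤ K ^ 2 / m * w ^ 2 := by positivity
  have h4 : K * (v ^ 2 + w ^ 2) + K * (h * v) + K * (ρ * w) + K * (ρ * v) - m * (ρ ^ 2 + h ^ 2)
      ≤ Q * (v ^ 2 + w ^ 2) - m / 2 * (ρ ^ 2 + h ^ 2) := by
    rw [hQ]
    linarith
  have h5 := mul_le_mul_of_nonneg_left h4 hε.le
  have h6 := mul_le_mul_of_nonneg_right hεQ (add_nonneg (sq_nonneg v) (sq_nonneg w))
  have h7 := mul_le_mul_of_nonneg_right (min_le_left (d / 2) (ε * (m / 2)))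
    (add_nonneg (sq_nonneg v) (sq_nonneg w))
  have h8 := mul_le_mul_of_nonneg_right (min_le_right (d / 2) (ε * (m / 2)))
    (add_nonneg (sq_nonneg ρ) (sq_nonneg h))
  linarith

/-! ### Quadratic bounds for the closed-loop Lyapunov function -/

namespace TetheredGuide

theorem abs_inner_act_le (M : Matrix (Fin 3) (Fin 3) ℝ) {K : ℝ}
    (hK : ‖toEuclideanCLM (n := Fin 3) (𝕜 := ℝ) M‖ ≤ K) (v w : E3) :
    |inner ℝ v (act M w)| ≤ K * (‖v‖ * ‖w‖) := by
  calc |inner ℝ v (act M w)| ≤ ‖v‖ * ‖act M w‖ := abs_real_inner_le_norm _ _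
    _ ≤ ‖v‖ * (K * ‖w‖) := by
        gcongr
        exact (norm_act_le M w).trans (by gcongr)
    _ = _ := by ring

/-- Sum of the squared norms of the components of `x - equilibriumState P fz pHr`. -/
noncomputable def errorSq (P : Params) (fz : ℝ) (pHr : E3) (x : State) : ℝ :=
  ‖x.pH - pHr‖ ^ 2 + ‖x.vH‖ ^ 2 + ‖x.pR - robotRef P fz pHr‖ ^ 2 + ‖x.vR‖ ^ 2

theorem norm_sub_equilibriumState (P : Params) (fz : ℝ) (pHr : E3) (x : State) :
    ‖x - equilibriumState P fz pHr‖
      = max ‖x.pH - pHr‖ (max ‖x.vH‖ (max ‖x.pR - robotRef P fz pHr‖ ‖x.vR‖)) := by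
  simp [Prod.norm_def, equilibriumState, State.pH, State.vH, State.pR, State.vR]

theorem sq_norm_le_errorSq (P : Params) (fz : ℝ) (pHr : E3) (x : State) :
    ‖x - equilibriumState P fz pHr‖ ^ 2 ≤ errorSq P fz pHr x := by
  rw [norm_sub_equilibriumState, errorSq]
  have h1 := sq_nonneg ‖x.pH - pHr‖
  have h2 := sq_nonneg ‖x.vH‖
  have h3 := sq_nonneg ‖x.pR - robotRef P fz pHr‖
  have h4 := sq_nonneg ‖x.vR‖
  rcases max_choice ‖x.pH - pHr‖ (max ‖x.vH‖ (max ‖x.pR - robotRef P fz pHr‖ ‖x.vR‖))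
    with h | h <;> rw [h]
  · linarith
  rcases max_choice ‖x.vH‖ (max ‖x.pR - robotRef P fz pHr‖ ‖x.vR‖) with h | h <;> rw [h]
  · linarith
  rcases max_choice ‖x.pR - robotRef P fz pHr‖ ‖x.vR‖ with h | h <;> rw [h] <;> linarith

theorem errorSq_le_sq_norm (P : Params) (fz : ℝ) (pHr : E3) (x : State) :
    errorSq P fz pHr x ≤ 4 * ‖x - equilibriumState P fz pHr‖ ^ 2 := by
  have hn := norm_sub_equilibriumState P fz pHr x
  have h1 : ‖x.pH - pHr‖ ^ 2 ≤ ‖x - equilibriumState P fz pHr‖ ^ 2 := by gcongr; simp [hn]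
  have h2 : ‖x.vH‖ ^ 2 ≤ ‖x - equilibriumState P fz pHr‖ ^ 2 := by gcongr; simp [hn]
  have h3 : ‖x.pR - robotRef P fz pHr‖ ^ 2 ≤ ‖x - equilibriumState P fz pHr‖ ^ 2 := by
    gcongr; simp [hn]
  have h4 : ‖x.vR‖ ^ 2 ≤ ‖x - equilibriumState P fz pHr‖ ^ 2 := by gcongr; simp [hn]
  rw [errorSq]
  linarith

theorem span_sub (P : Params) (hkc : 0 < P.kc) {fz : ℝ} (hfz : fz ≠ 0) (pHr : E3) (x : State) :
    x.pR - x.pH - eqLength P fz • eqDir fz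
      = (x.pR - robotRef P fz pHr) - (x.pH - pHr) := by
  rw [← robotRef_sub P hkc hfz pHr]
  abel

/-- Each end moves by less than half the equilibrium stretch, so the cable stays longer than
`P.len`. -/
theorem taut_of_near (P : Params) (hkc : 0 < P.kc) (hlen : 0 < P.len) {fz : ℝ} (hfz : fz ≠ 0)
    (pHr : E3) {x : State}
    (hx : ‖x - equilibriumState P fz pHr‖ < (eqLength P fz - P.len) / 2) :
    P.len < ‖x.pR - x.pH‖ := by
  have hR0 : 0 < eqLength P fz := hlen.trans (len_lt_eqLength P hkc hfz)
  have hn := norm_sub_equilibriumState P fz pHr x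
  have h1 : ‖x.pH - pHr‖ ≤ ‖x - equilibriumState P fz pHr‖ := by simp [hn]
  have h3 : ‖x.pR - robotRef P fz pHr‖ ≤ ‖x - equilibriumState P fz pHr‖ := by simp [hn]
  have h4 := norm_sub_le (x.pR - robotRef P fz pHr) (x.pH - pHr)
  rw [← span_sub P hkc hfz] at h4
  have h5 := norm_sub_norm_le (eqLength P fz • eqDir fz) (x.pR - x.pH)
  rw [norm_smul, norm_eqDir hfz, mul_one, Real.norm_eq_abs, abs_of_pos hR0, 
    norm_sub_rev (eqLength P fz • eqDir fz)] at h5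
  linarith

set_option maxHeartbeats 1000000 in
theorem exists_isQuadraticLyapunov (P : Params) (hmH : 0 < P.mH) (hkc : 0 < P.kc)
    (hlen : 0 < P.len) (hMA : P.MA.PosDef) (hDA : P.DA.PosDef) {kp : ℝ} (hkp : 0 < kp)
    {fz : ℝ} (hfz : fz ≠ 0) {pHr : E3} (hpHr : inner ℝ zW pHr = (0 : ℝ))
    (hD : (P.DH - (1 / 4 : ℝ) • P.DA).PosDef) :
    ∃ W W' : State → ℝ, ∃ a b c r : ℝ, IsQuadraticLyapunov (closedLoop P kp fz pHr) stateSet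
      (equilibriumState P fz pHr) W W' a b c r := by
  have hR := len_lt_eqLength P hkc hfz
  have hR0 : 0 < eqLength P fz := hlen.trans hR
  have hRL : 0 < eqLength P fz - P.len := sub_pos.2 hR
  set μ := P.kc * (eqLength P fz - P.len) / (2 * eqLength P fz) with hμ
  have hμ0 : 0 < μ := by positivity
  obtain ⟨d, hd, hdiss⟩ := exists_le_dissipation hDA hD
  obtain ⟨cM, hcM, hM⟩ := exists_le_inner_act hMA
  -- Gain `kp / 2` serves the energy bound, where the spring carries a factor 1/2; gain `kp` serves
  -- the decay.
  obtain ⟨m₁, hm₁, hs₁⟩ := exists_le_spring_energy (V := E3) (half_pos hkp) hμ0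
  obtain ⟨m₂, hm₂, hs₂⟩ := exists_le_spring_energy (V := E3) hkp hμ0
  set K := P.mH + P.kc + kp + ‖toEuclideanCLM (n := Fin 3) (𝕜 := ℝ) P.MA‖
    + ‖toEuclideanCLM (n := Fin 3) (𝕜 := ℝ) P.DH‖
    + ‖toEuclideanCLM (n := Fin 3) (𝕜 := ℝ) P.DA‖ with hK
  have nMA := norm_nonneg (toEuclideanCLM (n := Fin 3) (𝕜 := ℝ) P.MA)
  have nDH := norm_nonneg (toEuclideanCLM (n := Fin 3) (𝕜 := ℝ) P.DH)
  have nDA := norm_nonneg (toEuclideanCLM (n := Fin 3) (𝕜 := ℝ) P.DA)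
  have hK0 : 0 < K := by positivity
  have hKm : P.mH ≤ K := by linarith
  have hKk : P.kc ≤ K := by linarith
  have hKp : kp ≤ K := by linarith
  have bMA := abs_inner_act_le P.MA (K := K) (by linarith)
  have bDH := abs_inner_act_le P.DH (K := K) (by linarith)
  have bDA := abs_inner_act_le P.DA (K := K) (by linarith)
  obtain ⟨ε₀, hε₀, hε₀c⟩ := exists_coupling_decay hd hm₂ hK0
  -- `a₀` is the coercivity constant of the energy at `ε = 0`; the bound `ε ≤ a₀ / K` lets the cross
  -- term consume at most half of it.
  set a₀ := min (P.mH / 2) (min (cM / 2) m₁) with ha₀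
  have ha₀0 : 0 < a₀ := by positivity
  set ε := min ε₀ (a₀ / K) with hε
  have hε0 : 0 < ε := by positivity
  have hεK : ε * K ≤ a₀ := (le_div_iff₀ hK0).1 (min_le_right _ _)
  obtain ⟨c, hc, hdecay⟩ := hε₀c ε hε0 (min_le_left _ _)
  have hcross : ∀ x : State, |P.mH * inner ℝ (x.pH - pHr) x.vH
      + inner ℝ (x.pR - robotRef P fz pHr) (act P.MA x.vR)| ≤ K / 2 * errorSq P fz pHr x := by
    intro x
    have h1 : |P.mH * inner ℝ (x.pH - pHr) x.vH| ≤ K * (‖x.pH - pHr‖ * ‖x.vH‖) := by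
      rw [abs_mul, abs_of_pos hmH]
      exact mul_le_mul hKm (abs_real_inner_le_norm _ _) (abs_nonneg _) hK0.le
    have h2 := bMA (x.pR - robotRef P fz pHr) x.vR
    refine (abs_add_le _ _).trans ((add_le_add h1 h2).trans ?_)
    rw [errorSq]
    have h3 := mul_nonneg hK0.le (sq_nonneg (‖x.pH - pHr‖ - ‖x.vH‖))
    have h4 := mul_nonneg hK0.le (sq_nonneg (‖x.pR - robotRef P fz pHr‖ - ‖x.vR‖))
    linarith
  have hpz : ∀ x ∈ stateSet, inner ℝ zW (x.pH - pHr) = (0 : ℝ) := by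
    intro x hx
    rw [inner_sub_right, hpHr, sub_zero]
    exact hx.1
  -- The factor 4 passes from the sum of four squares to the maximum norm on `State`; the radius
  -- keeps the cable taut.
  refine ⟨lyapunov P kp fz pHr ε, lyapunovDeriv P kp fz pHr ε, a₀ / 2,
    4 * (2 * K + ε * (K / 2)), c, (eqLength P fz - P.len) / 2,
    ⟨by positivity, by positivity, hc, by positivity, ?_, ?_, ?_, ?_⟩⟩
  · intro x hx _
    refine (mul_le_mul_of_nonneg_left (sq_norm_le_errorSq P fz pHr x) (by positivity)).trans ?_
    have h1 := hM x.vR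
    have h2 := hs₁ zW (x.pH - pHr) (x.pR - robotRef P fz pHr) norm_zW (hpz x hx)
    have h3 := le_cableEnergy hkc hlen hR (norm_eqDir hfz) (x.pR - x.pH)
    rw [← hμ, span_sub P hkc hfz pHr] at h3
    have h4 := mul_le_mul_of_nonneg_left (neg_le_of_abs_le (hcross x)) hε0.le
    have h5 : ε * (K / 2 * errorSq P fz pHr x) ≤ a₀ / 2 * errorSq P fz pHr x := by
      have h0 : 0 ≤ errorSq P fz pHr x := by unfold errorSq; positivity
      linarith [mul_le_mul_of_nonneg_right hεK h0]
    have i1 : a₀ * ‖x.vH‖ ^ 2 ≤ P.mH / 2 * ‖x.vH‖ ^ 2 := by gcongr; exact min_le_left _ _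
    have i2 : a₀ * ‖x.vR‖ ^ 2 ≤ cM / 2 * ‖x.vR‖ ^ 2 := by
      gcongr; exact (min_le_right _ _).trans (min_le_left _ _)
    have i3 : a₀ * (‖x.pR - robotRef P fz pHr‖ ^ 2 + ‖x.pH - pHr‖ ^ 2)
        ≤ m₁ * (‖x.pR - robotRef P fz pHr‖ ^ 2 + ‖x.pH - pHr‖ ^ 2) := by
      gcongr; exact (min_le_right _ _).trans (min_le_right _ _)
    rw [lyapunov, inner_act_gainMatrix]
    rw [errorSq] at *
    linarith
  · intro x hx _
    suffices h : lyapunov P kp fz pHr ε x ≤ (2 * K + ε * (K / 2)) * errorSq P fz pHr x by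
      have := mul_le_mul_of_nonneg_left (errorSq_le_sq_norm P fz pHr x)
        (by positivity : 0 ≤ 2 * K + ε * (K / 2))
      linarith
    have h1 := (le_abs_self _).trans (bMA x.vR x.vR)
    have h3 := cableEnergy_le (R := eqLength P fz) hkc hlen (norm_eqDir hfz) (x.pR - x.pH)
    rw [span_sub P hkc hfz pHr] at h3
    have h4 := mul_le_mul_of_nonneg_left (le_of_abs_le (hcross x)) hε0.le
    have h5 : ‖(x.pR - robotRef P fz pHr) - (x.pH - pHr)‖ ^ 2
        ≤ 2 * ‖x.pR - robotRef P fz pHr‖ ^ 2 + 2 * ‖x.pH - pHr‖ ^ 2 := norm_sub_sq_le _ _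
    have i1 : P.mH * ‖x.vH‖ ^ 2 ≤ K * ‖x.vH‖ ^ 2 := by gcongr
    have i2 : kp * (‖x.pR - robotRef P fz pHr‖ ^ 2 - inner ℝ zW (x.pR - robotRef P fz pHr) ^ 2)
        ≤ K * ‖x.pR - robotRef P fz pHr‖ ^ 2 := by
      have := mul_nonneg hkp.le (sq_nonneg (inner ℝ zW (x.pR - robotRef P fz pHr) : ℝ))
      have : kp * ‖x.pR - robotRef P fz pHr‖ ^ 2 ≤ K * ‖x.pR - robotRef P fz pHr‖ ^ 2 := by gcongr
      linarith
    have i3 : P.kc * ‖(x.pR - robotRef P fz pHr) - (x.pH - pHr)‖ ^ 2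
        ≤ K * (2 * ‖x.pR - robotRef P fz pHr‖ ^ 2 + 2 * ‖x.pH - pHr‖ ^ 2) := by gcongr
    have j1 : 0 ≤ K * ‖x.vH‖ ^ 2 := by positivity
    have j2 : 0 ≤ K * ‖x.vR‖ ^ 2 := by positivity
    have j3 : 0 ≤ K * ‖x.pR - robotRef P fz pHr‖ ^ 2 := by positivity
    have j4 : 0 ≤ K * ‖x.pH - pHr‖ ^ 2 := by positivity
    rw [lyapunov, inner_act_gainMatrix]
    rw [errorSq] at *
    linarith
  · intro φ s t hX hr h
    exact hasDerivWithinAt_lyapunov P hmH hkc hlen hMA kp hfz hpHr ε hX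
      (taut_of_near P hkc hlen hfz pHr hr) h
  · intro x hx hr
    have htaut := taut_of_near P hkc hlen hfz pHr hr
    have h1 := mul_le_mul_of_nonneg_left (sq_norm_le_errorSq P fz pHr x) hc.le
    have h2 := hdecay ‖x.vH‖ ‖x.vR‖ ‖x.pH - pHr‖ ‖x.pR - robotRef P fz pHr‖
    have h3 := hdiss x.vH x.vR
    have h4 := hs₂ zW (x.pH - pHr) (x.pR - robotRef P fz pHr) norm_zW (hpz x hx)
    have h5 := le_inner_cable_force hkc hlen hR (norm_eqDir hfz) htaut.le
    rw [← hμ, ← cableForce_of_taut P htaut, smul_eqDir P hkc hfz, span_sub P hkc hfz pHr] at h5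
    have b1 := (le_abs_self _).trans (bMA x.vR x.vR)
    have b2 := neg_le_of_abs_le (bDH (x.pH - pHr) x.vH)
    have b3 := neg_le_of_abs_le (bDA (x.pR - robotRef P fz pHr) x.vR)
    have b4 := le_of_abs_le (bDA (x.pR - robotRef P fz pHr) x.vH)
    have i1 : P.mH * ‖x.vH‖ ^ 2 ≤ K * ‖x.vH‖ ^ 2 := by gcongr
    refine le_trans ?_ (h2.trans (by rw [errorSq] at h1; linarith))
    rw [lyapunovDeriv, inner_act_gainMatrix]
    refine add_le_add (by linarith) (mul_le_mul_of_nonneg_left ?_ hε0.le)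
    linarith

theorem equilibriumState_mem_stateSet (P : Params) (fz : ℝ) {pHr : E3}
    (hpHr : inner ℝ zW pHr = (0 : ℝ)) : equilibriumState P fz pHr ∈ stateSet :=
  ⟨hpHr, inner_zero_right _⟩

end TetheredGuide

theorem theorem3 (P : TetheredGuide.Params)
    (hmH : 0 < P.mH) (hkc : 0 < P.kc) (hlen : 0 < P.len) (hgrav : 0 < P.grav)
    (hDH : P.DH.PosDef) (hMA : P.MA.PosDef) (hDA : P.DA.PosDef)
    (kp : ℝ) (hkp : 0 < kp) (fz : ℝ) (hfz : fz ≠ 0)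
    (pHr : TetheredGuide.E3) (hpHr : inner ℝ TetheredGuide.zW pHr = 0)
    (hD : (P.DH - (1 / 4 : ℝ) • P.DA).PosDef) :
    IsAsymptoticallyStableEquilibrium
      (TetheredGuide.closedLoop P kp fz pHr)
      TetheredGuide.stateSet
      (TetheredGuide.equilibriumState P fz pHr) := by
  obtain ⟨W, W', a, b, c, r, h⟩ := TetheredGuide.exists_isQuadraticLyapunov P hmH hkc hlen hMA hDA
    hkp hfz hpHr hD
  have htaut : P.len < ‖(TetheredGuide.equilibriumState P fz pHr).pR
      - (TetheredGuide.equilibriumState P fz pHr).pH‖ := by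
    refine TetheredGuide.taut_of_near P hkc hlen hfz pHr ?_
    rw [sub_self, norm_zero]
    linarith [TetheredGuide.len_lt_eqLength P hkc hfz]
  exact ⟨TetheredGuide.equilibriumState_mem_stateSet P fz hpHr,
    TetheredGuide.closedLoop_equilibriumState P hkc hlen kp hfz pHr, h.isStableAt,
    h.isLocallyAttractiveAt (TetheredGuide.contDiffAt_closedLoop P hlen kp fz pHr htaut)
      fun φ T _ => TetheredGuide.isSolutionOn_stateSet P kp fz pHr φ T⟩
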